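/- Let $|0\rangle,|1\rangle,|2\rangle,|3\rangle$ be the computational basis of $\mathbb{C}^4$ and write $|\eta_\pm\rangle=(|0\rangle\pm|1\rangle)/\sqrt2$, $|\xi_\pm\rangle=(|1\rangle\pm|2\rangle)/\sqrt2$, $|\chi_\pm\rangle=(|2\rangle\pm|3\rangle)/\sqrt2$. Let $\mathcal{B}=\{|0\rangle|\eta_\pm\rangle,\ |\eta_\pm\rangle|2\rangle,\ |2\rangle|\xi_\pm\rangle,\ |\xi_\pm\rangle|0\rangle,\ |1\rangle|1\rangle\}$ (nine two-party product states), let $\mathcal{S}=\{|3\rangle_A|\beta\rangle_{BC},\ |\beta\rangle_{AB}|3\rangle_C : |\beta\rangle\in\mathcal{B}\}$, and let $\mathcal{R}$ be the set of the $46$ states $|i\rangle|j\rangle|k\rangle$ with either $i,j,k\in\{0,1,2\}$; or $i\in\{0,1,2\}$, $j=3$, $k\in\{0,1,2,3\}$; or $i=3$, $j\in\{0,1,2\}$, $k=3$; or $i=j=3$, $k\in\{0,1,2,3\}$. Put $\mathbb{B}_I(4,3)=\mathcal{S}\cup\mathcal{R}$ and $$\mathbb{B}_{II}(4,3)=\Big(\mathbb{B}_I(4,3)\setminus\{|0\rangle|3\rangle|2\rangle,|0\rangle|3\rangle|3\rangle,|2\rangle|2\rangle|2\rangle,|2\rangle|3\rangle|2\rangle,|2\rangle|3\rangle|1\rangle,|3\rangle|3\rangle|1\rangle\}\Big)\cup\{|0\rangle|3\rangle|\chi_\pm\rangle,\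 |2\rangle|\chi_\pm\rangle|2\rangle,\ |\chi_\pm\rangle|3\rangle|1\rangle\}.$$ Then $\mathbb{B}_{II}(4,3)$ is a genuinely nonlocal product basis of $(\mathbb{C}^4)^{\otimes 3}$: it is an orthonormal basis consisting of product states, and its states cannot be perfectly discriminated by LOCC even if any two of the three parties come together, i.e. for none of the bipartitions $A|BC$, $B|AC$, $C|AB$. Furthermore, $\mathbb{B}_{II}(4,3)$ is locally irreducible when all three parties are separated: no orthogonality preserving local measurements of the single parties eliminate a state of the set. Here an LOCC protocol has any finite number of rounds; in each round one of the (groups of) parties measures its own system, with finitely many outcomes, and announces the outcome, and all further actions (including local isometries of the others) may depend on the outcomes announced so far. It perfectly discriminates a set of states if every possible record of outcomes has nonzero probability for at most one state of the set. A protocol is orthogonality preserving on a set if after each measurement, for each outcome, the (unnormalized) post-measurement states are mutually orthogonal; it eliminates a state if some record of outcomes has probability zero for this state, but positive probability for another state of the set. -/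

import Mathlib

open scoped Matrix

noncomputable section

/-! ### Multipartite Hilbert spaces, product states, orthogonal product bases -/

/-- The Hilbert space `⨂ k, ℂ^(X k)` of a composite system whose parties are labelled by `κ`, party
`k` having the computational basis `X k`.  A vector is given by its coordinates in the product
basis. -/
abbrev MultiSpace {κ : Type} (X : κ → Type) : Type := EuclideanSpace ℂ (∀ k, X k)

/-- The product vector `⨂ k, α k`. -/
def prodState {κ : Type} [Fintype κ] {X : κ → Type}
    (α : ∀ k, EuclideanSpace ℂ (X k)) : MultiSpace X :=
  WithLp.toLp 2 fun x => ∏ k, α k (x k)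

/-- The operator `⨂ k, A k` between two composite systems with the same parties, applied to a
vector. -/
def applyLocal {κ : Type} [Fintype κ] [DecidableEq κ] {X Y : κ → Type} [∀ k, Fintype (X k)]
    (A : ∀ k, Matrix (Y k) (X k) ℂ) (ψ : MultiSpace X) : MultiSpace Y :=
  WithLp.toLp 2 fun y => ∑ x : ∀ k, X k, (∏ k, A k (y k) (x k)) * ψ x

/-- An orthogonal product basis (of normalized states) of `⨂ k, ℂ^(X k)`. -/
def IsOrthogonalProductBasis {κ : Type} [Fintype κ] [DecidableEq κ] {X : κ → Type}
    [∀ k, Fintype (X k)] (B : Set (MultiSpace X)) : Prop :=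
  Orthonormal ℂ (fun ψ : B => (ψ : MultiSpace X)) ∧
    Submodule.span ℂ B = ⊤ ∧
    ∀ ψ ∈ B, ∃ α : ∀ k, EuclideanSpace ℂ (X k), ψ = prodState α

/-! ### LOCC protocols -/

/-- An LOCC protocol with finitely many rounds, for parties `κ` that hold systems with the
computational bases `X k`.  Either the protocol stops, or a party `p` performs a quantum measurement
on its own system, with finitely many outcomes `o` and the Kraus operators `K o p`, and announces
the outcome.  Knowing it, every other party `q` may embed its system isometrically (by `K o q`) into
another one, for example by adjoining an ancilla or by applying a unitary.  The protocol then goes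
on in a way that depends on the outcome.  The dimensions of the systems after the round are arbitrary
and may depend on the outcome. -/
inductive LOCC {κ : Type} : (X : κ → Type) → [∀ k, DecidableEq (X k)] → Type 1
  | halt {X : κ → Type} [∀ k, DecidableEq (X k)] : LOCC X
  | round {X : κ → Type} [∀ k, DecidableEq (X k)] (p : κ) (m : ℕ) (n : Fin m → κ → ℕ)
      (K : ∀ (o : Fin m) (q : κ), Matrix (Fin (n o q)) (X q) ℂ)
      (complete : ∑ o, (K o p)ᴴ * K o p = 1)
      (isometric : ∀ (o : Fin m) (q : κ), q ≠ p → (K o q)ᴴ * K o q = 1)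
      (next : ∀ o : Fin m, LOCC (fun q => Fin (n o q))) : LOCC X

namespace LOCC

variable {κ : Type} [Fintype κ] [DecidableEq κ] {J : Type}

/-- The protocol perfectly discriminates the states of the family `φ`: whenever it stops, the
observed outcomes have probability zero for all states but one, which is then announced.  (The
post-measurement states are not normalized: the squared norm is the probability of the outcomes
observed so far.) -/
def PerfectlyDiscriminates : {X : κ → Type} → [∀ k, DecidableEq (X k)] → [∀ k, Fintype (X k)] →
    LOCC X → (J → MultiSpace X) → Prop
  | _, _, _, halt, φ => ∃ j, ∀ i, i ≠ j → φ i = 0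
  | _, _, _, round _ _ _ K _ _ next, φ =>
      ∀ o, PerfectlyDiscriminates (next o) (fun j => applyLocal (K o) (φ j))

/-- Every measurement of the protocol is orthogonality preserving: for each of its outcomes the
post-measurement states are mutually orthogonal. -/
def OrthogonalityPreserving : {X : κ → Type} → [∀ k, DecidableEq (X k)] → [∀ k, Fintype (X k)] →
    LOCC X → (J → MultiSpace X) → Prop
  | _, _, _, halt, _ => True
  | _, _, _, round _ _ _ K _ _ next, φ => ∀ o,
      (∀ i j, i ≠ j → inner ℂ (applyLocal (K o) (φ i)) (applyLocal (K o) (φ j)) = 0) ∧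
      OrthogonalityPreserving (next o) (fun j => applyLocal (K o) (φ j))

/-- Some outcome of the protocol, possible for at least one state of the family, is impossible for
another one, which is thereby eliminated. -/
def Eliminates : {X : κ → Type} → [∀ k, DecidableEq (X k)] → [∀ k, Fintype (X k)] →
    LOCC X → (J → MultiSpace X) → Prop
  | _, _, _, halt, φ => (∃ i, φ i = 0) ∧ ∃ j, φ j ≠ 0
  | _, _, _, round _ _ _ K _ _ next, φ =>
      ∃ o, Eliminates (next o) (fun j => applyLocal (K o) (φ j))

end LOCC

/-! ### Parties that come together -/

/-- If the parties `ι` come together in groups according to `g : ι → κ`, then group `k` holds the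
systems of all the parties `i` with `g i = k`. -/
abbrev Grouped {ι κ : Type} (g : ι → κ) (X : ι → Type) (k : κ) : Type := ∀ i : {i // g i = k}, X i

/-- A state of the parties `ι`, seen as a state of the groups. -/
def regroup {ι κ : Type} (g : ι → κ) {X : ι → Type} (ψ : MultiSpace X) : MultiSpace (Grouped g X) :=
  WithLp.toLp 2 fun y => ψ fun i => y (g i) ⟨i, rfl⟩

/-- A genuinely nonlocal product basis: an orthogonal product basis whose states cannot be perfectly
discriminated by LOCC even if all the parties but one (whichever it is) come together. -/
def IsGenuinelyNonlocalProductBasis {ι : Type} [Fintype ι] [DecidableEq ι] {X : ι → Type}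
    [∀ i, Fintype (X i)] [∀ i, DecidableEq (X i)] (B : Set (MultiSpace X)) : Prop :=
  IsOrthogonalProductBasis B ∧
    ∀ a : ι, ¬ ∃ P : LOCC (Grouped (fun i : ι => decide (i = a)) X),
      P.PerfectlyDiscriminates
        (fun ψ : B => regroup (fun i : ι => decide (i = a)) (ψ : MultiSpace X))

/-- Local irreducibility with all the parties separated: no sequence of orthogonality preserving
local measurements of the single parties eliminates a state of the set. -/
def IsLocallyIrreducible {ι : Type} [Fintype ι] [DecidableEq ι] {X : ι → Type}
    [∀ i, Fintype (X i)] [∀ i, DecidableEq (X i)] (B : Set (MultiSpace X)) : Prop :=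
  ∀ P : LOCC X, P.OrthogonalityPreserving (fun ψ : B => (ψ : MultiSpace X)) →
    ¬ P.Eliminates (fun ψ : B => (ψ : MultiSpace X))

/-! ### The states -/

/-- The system `ℂ⁴`. -/
abbrev Ququart : Type := EuclideanSpace ℂ (Fin 4)

/-- The space `ℂ⁴ ⊗ ℂ⁴ ⊗ ℂ⁴`. -/
abbrev ThreeQuquarts : Type := MultiSpace (fun _ : Fin 3 => Fin 4)

/-- The computational basis state `|i⟩` of `ℂ⁴`. -/
def ket (i : Fin 4) : Ququart := EuclideanSpace.single i 1

/-- `(|i⟩ + |j⟩) / √2`. -/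
def plus (i j : Fin 4) : Ququart := (1 / (Real.sqrt 2 : ℂ)) • (ket i + ket j)

/-- `(|i⟩ - |j⟩) / √2`. -/
def minus (i j : Fin 4) : Ququart := (1 / (Real.sqrt 2 : ℂ)) • (ket i - ket j)

/-- The pair `|η₊⟩, |η₋⟩`. -/
def etaStates : Set Ququart := {plus 0 1, minus 0 1}

/-- The pair `|ξ₊⟩, |ξ₋⟩`. -/
def xiStates : Set Ququart := {plus 1 2, minus 1 2}

/-- The pair `|χ₊⟩, |χ₋⟩`. -/
def chiStates : Set Ququart := {plus 2 3, minus 2 3}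

/-- The product state `|a⟩|b⟩|c⟩`. -/
def tri (a b c : Ququart) : ThreeQuquarts :=
  prodState (X := fun _ : Fin 3 => Fin 4) ![a, b, c]

/-- The nine two-qutrit product states `|β⟩ = |b₁⟩|b₂⟩`, written as the pairs `(b₁, b₂)`, with
`ℂ³ ⊆ ℂ⁴` spanned by `|0⟩, |1⟩, |2⟩`. -/
def dominoes : Set (Ququart × Ququart) :=
  {b | b.1 = ket 0 ∧ b.2 ∈ etaStates} ∪ {b | b.1 ∈ etaStates ∧ b.2 = ket 2} ∪
  {b | b.1 = ket 2 ∧ b.2 ∈ xiStates} ∪ {b | b.1 ∈ xiStates ∧ b.2 = ket 0} ∪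
  {(ket 1, ket 1)}

/-- The eighteen states `|3⟩|β⟩` and `|β⟩|3⟩`. -/
def setS : Set ThreeQuquarts :=
  {ψ | ∃ b ∈ dominoes, ψ = tri (ket 3) b.1 b.2} ∪ {ψ | ∃ b ∈ dominoes, ψ = tri b.1 b.2 (ket 3)}

/-- The labels of the computational basis states that belong to the first basis. -/
def labelsR : Finset (Fin 4 × Fin 4 × Fin 4) :=
  {(3, 0, 3), (3, 1, 3), (3, 2, 3), (3, 3, 0), (3, 3, 1), (3, 3, 2), (3, 3, 3),
   (2, 0, 0), (2, 0, 1), (2, 0, 2), (2, 1, 0), (2, 1, 1), (2, 1, 2), (2, 2, 0),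
   (2, 2, 1), (2, 2, 2), (2, 3, 0), (2, 3, 1), (2, 3, 2), (2, 3, 3),
   (0, 0, 0), (0, 0, 1), (0, 0, 2), (0, 1, 0), (0, 1, 1), (0, 1, 2), (0, 2, 0),
   (0, 2, 1), (0, 2, 2), (0, 3, 0), (0, 3, 1), (0, 3, 2), (0, 3, 3),
   (1, 0, 0), (1, 0, 1), (1, 0, 2), (1, 1, 0), (1, 1, 1), (1, 1, 2), (1, 2, 0),
   (1, 2, 1), (1, 2, 2), (1, 3, 0), (1, 3, 1), (1, 3, 2), (1, 3, 3)}

/-- The forty-six computational basis states of the first basis. -/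
def setR : Set ThreeQuquarts :=
  {ψ | ∃ l ∈ labelsR, ψ = tri (ket l.1) (ket l.2.1) (ket l.2.2)}

/-- The basis `B_I(4,3)`. -/
def basisI : Set ThreeQuquarts := setS ∪ setR

/-- The basis `B_II(4,3)`. -/
def basisII : Set ThreeQuquarts :=
  (basisI \
    {tri (ket 0) (ket 3) (ket 2), tri (ket 0) (ket 3) (ket 3),
     tri (ket 2) (ket 2) (ket 2), tri (ket 2) (ket 3) (ket 2),
     tri (ket 2) (ket 3) (ket 1), tri (ket 3) (ket 3) (ket 1)}) ∪
  ({ψ | ∃ c ∈ chiStates, ψ = tri (ket 0) (ket 3) c} ∪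
   {ψ | ∃ c ∈ chiStates, ψ = tri (ket 2) c (ket 2)} ∪
   {ψ | ∃ c ∈ chiStates, ψ = tri c (ket 3) (ket 1)})

end

/-!
The proof rests on one linear property of a family of states, rigidity (`IsRigid`): if an operator
`M` on the system of a single party satisfies `⟪φ i, M φ j⟫ = 0` for all `i ≠ j`, then `M` is a
multiple of the identity.  For a Kraus operator `K` of an orthogonality preserving measurement, this
applies to `M = Kᴴ K`, so that `K` is a multiple of an isometry.

* A rigid family is locally irreducible (`LOCC.not_eliminates_of_isRigid`): along an orthogonality
  preserving protocol the states always remain images of the original ones under operators `A k`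
  with scalar `(A k)ᴴ (A k)`, hence all of them vanish or none does.
* A rigid family cannot be perfectly discriminated, even after local isometric embeddings and
  together with other states (`LOCC.not_perfectlyDiscriminates_of_isRigid`): states that are
  perfectly discriminated in the end are orthogonal at every earlier stage, because inner products
  add up over the outcomes.  So the same invariant holds, and since probabilities add up as well,
  one can follow a branch of nonzero probability until the protocol stops with several nonzero
  states.

Rigidity of a set of product states with factors `|i⟩` and `(|i⟩ ± |i+1⟩)/√2` is a matter of
combinatorics (`isRigid_of_labels`): a pair of states with `|i⟩` and `|j⟩` at the party in question,
and non-orthogonal factors elsewhere, kills the entry `M i j`; a pair with `(|i⟩ ± |i+1⟩)/√2` then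
makes two neighbouring diagonal entries equal.  Both `B_II(4,3)` and the nine two-qutrit domino
states have enough such pairs.  For every bipartition, one of the two copies `|β⟩|3⟩` and `|3⟩|β⟩`
of the dominoes is shared between the two sides, the factor `|3⟩` being a mere ancilla of one of
them (`regroup_labelState`); this gives genuine nonlocality.

Orthonormality is checked on the labels of the factors, and completeness follows by counting: there
are `64 = 4³` labels.
-/

/-! ### Local operators -/

section LocalOperators

theorem prodState_apply {κ : Type} [Fintype κ] {X : κ → Type}
    (α : ∀ k, EuclideanSpace ℂ (X k)) (x : ∀ k, X k) :
    prodState α x = ∏ k, α k (x k) := rfl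

variable {κ : Type} [Fintype κ] [DecidableEq κ]

theorem applyLocal_apply {X Y : κ → Type} [∀ k, Fintype (X k)]
    (A : ∀ k, Matrix (Y k) (X k) ℂ) (ψ : MultiSpace X) (y : ∀ k, Y k) :
    applyLocal A ψ y = ∑ x : ∀ k, X k, (∏ k, A k (y k) (x k)) * ψ x := rfl

theorem applyLocal_comp {X Y Z : κ → Type} [∀ k, Fintype (X k)] [∀ k, Fintype (Y k)]
    (A : ∀ k, Matrix (Z k) (Y k) ℂ) (B : ∀ k, Matrix (Y k) (X k) ℂ) (ψ : MultiSpace X) :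
    applyLocal A (applyLocal B ψ) = applyLocal (fun k => A k * B k) ψ := by
  ext z
  simp only [applyLocal_apply, Matrix.mul_apply, Finset.prod_univ_sum, Fintype.piFinset_univ,
    Finset.mul_sum, Finset.sum_mul, Finset.prod_mul_distrib]
  rw [Finset.sum_comm]
  simp only [mul_assoc]

theorem applyLocal_prodState {X Y : κ → Type} [∀ k, Fintype (X k)]
    (A : ∀ k, Matrix (Y k) (X k) ℂ) (α : ∀ k, EuclideanSpace ℂ (X k)) :
    applyLocal A (prodState α) = prodState fun k => WithLp.toLp 2 (A k *ᵥ α k) := by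
  ext y
  simp only [applyLocal_apply, prodState_apply, Matrix.mulVec, dotProduct, Finset.prod_univ_sum,
    Fintype.piFinset_univ, Finset.prod_mul_distrib]

theorem inner_prodState {X : κ → Type} [∀ k, Fintype (X k)]
    (α β : ∀ k, EuclideanSpace ℂ (X k)) :
    inner ℂ (prodState α) (prodState β) = ∏ k, inner ℂ (α k) (β k) := by
  simp only [PiLp.inner_apply, prodState_apply, Finset.prod_univ_sum, Fintype.piFinset_univ,
    RCLike.inner_apply, map_prod, Finset.prod_mul_distrib]

theorem inner_applyLocal_left {X Y : κ → Type} [∀ k, Fintype (X k)] [∀ k, Fintype (Y k)]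
    (A : ∀ k, Matrix (Y k) (X k) ℂ) (ψ : MultiSpace X) (χ : MultiSpace Y) :
    inner ℂ (applyLocal A ψ) χ = inner ℂ ψ (applyLocal (fun k => (A k)ᴴ) χ) := by
  simp only [PiLp.inner_apply, applyLocal_apply, RCLike.inner_apply, map_sum, map_mul, map_prod,
    Finset.mul_sum, Finset.sum_mul, Matrix.conjTranspose_apply, RCLike.star_def]
  rw [Finset.sum_comm]
  exact Finset.sum_congr rfl fun x _ => Finset.sum_congr rfl fun y _ => by ring

theorem inner_applyLocal_applyLocal {X Y : κ → Type} [∀ k, Fintype (X k)] [∀ k, Fintype (Y k)]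
    (A : ∀ k, Matrix (Y k) (X k) ℂ) (ψ φ : MultiSpace X) :
    inner ℂ (applyLocal A ψ) (applyLocal A φ) =
      inner ℂ ψ (applyLocal (fun k => (A k)ᴴ * A k) φ) := by
  rw [inner_applyLocal_left, applyLocal_comp]

theorem applyLocal_smul {X Y : κ → Type} [∀ k, Fintype (X k)] (c : κ → ℂ)
    (A : ∀ k, Matrix (Y k) (X k) ℂ) (ψ : MultiSpace X) :
    applyLocal (fun k => c k • A k) ψ = (∏ k, c k) • applyLocal A ψ := by
  ext y
  simp only [applyLocal_apply, PiLp.smul_apply, smul_eq_mul, Matrix.smul_apply,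
    Finset.prod_mul_distrib, Finset.mul_sum, mul_assoc]

theorem applyLocal_one {X : κ → Type} [∀ k, Fintype (X k)] [∀ k, DecidableEq (X k)]
    (ψ : MultiSpace X) : applyLocal (fun _ => 1) ψ = ψ := by
  ext y
  simp [applyLocal_apply, Matrix.one_apply, Finset.prod_boole, ← funext_iff]

/-- The operator that acts as `M` on the system of the party `p` and trivially elsewhere. -/
def applyAt {X : κ → Type} [∀ k, Fintype (X k)] [∀ k, DecidableEq (X k)] (p : κ)
    (M : Matrix (X p) (X p) ℂ) (ψ : MultiSpace X) : MultiSpace X :=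
  applyLocal (Function.update (fun _ => 1) p M) ψ

theorem sum_applyAt {X : κ → Type} [∀ k, Fintype (X k)] [∀ k, DecidableEq (X k)] {O : Type}
    [Fintype O] (p : κ) (M : O → Matrix (X p) (X p) ℂ) (hM : ∑ o, M o = 1) (ψ : MultiSpace X) :
    ∑ o, applyAt p (M o) ψ = ψ := by
  have key : ∑ o, applyAt p (M o) ψ = applyAt p (∑ o, M o) ψ := by
    ext y
    simp only [applyAt, WithLp.ofLp_sum, Finset.sum_apply, applyLocal_apply]
    rw [Finset.sum_comm]
    refine Finset.sum_congr rfl fun x _ => ?_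
    simp only [← Finset.sum_mul]
    congr 1
    simp only [Fintype.prod_eq_mul_prod_compl p, Function.update_self, Matrix.sum_apply,
      Finset.sum_mul]
    refine Finset.sum_congr rfl fun o _ => ?_
    congr 1
    refine Finset.prod_congr rfl fun k hk => ?_
    have hk' : k ≠ p := by simpa using hk
    rw [Function.update_of_ne hk', Function.update_of_ne hk']
  rw [key, hM, applyAt, Function.update_eq_self_iff.mpr rfl, applyLocal_one]

theorem inner_applyAt_prodState {X : κ → Type} [∀ k, Fintype (X k)] [∀ k, DecidableEq (X k)]
    (p : κ) (M : Matrix (X p) (X p) ℂ) (α β : ∀ k, EuclideanSpace ℂ (X k)) :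
    inner ℂ (prodState α) (applyAt p M (prodState β)) =
      inner ℂ (α p) (WithLp.toLp 2 (M *ᵥ β p)) * ∏ k ∈ {p}ᶜ, inner ℂ (α k) (β k) := by
  rw [applyAt, applyLocal_prodState, inner_prodState, Fintype.prod_eq_mul_prod_compl p,
    Function.update_self]
  congr 1
  refine Finset.prod_congr rfl fun k hk => ?_
  have hk' : k ≠ p := by simpa using hk
  rw [Function.update_of_ne hk', Matrix.one_mulVec]

end LocalOperators

/-! ### Rigid families of states -/

section Rigidity

variable {κ : Type} [Fintype κ] [DecidableEq κ] {J : Type}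

/-- A family of states is rigid if the only operators `M` of a single party for which
`⟪φ i, M φ j⟫ = 0` whenever `i ≠ j` are the multiples of the identity.  With `M = Kᴴ K`, it follows
that every orthogonality preserving Kraus operator `K` of a single party is a multiple of an
isometry. -/
def IsRigid {X : κ → Type} [∀ k, Fintype (X k)] [∀ k, DecidableEq (X k)]
    (φ : J → MultiSpace X) : Prop :=
  ∀ (p : κ) (M : Matrix (X p) (X p) ℂ),
    (∀ i j, i ≠ j → inner ℂ (φ i) (applyAt p M (φ j)) = 0) → ∃ c : ℂ, M = c • 1

/-- The Gram matrices of all factors but the `p`-th being scalar, orthogonality of the transformed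
states is a condition on the Gram matrix of the `p`-th factor alone. -/
theorem inner_applyLocal_of_scalar {X Y : κ → Type} [∀ k, Fintype (X k)]
    [∀ k, DecidableEq (X k)] [∀ k, Fintype (Y k)] (A : ∀ k, Matrix (Y k) (X k) ℂ) (c : κ → ℂ)
    (p : κ) (hc : ∀ k, k ≠ p → (A k)ᴴ * A k = c k • 1) (ψ φ : MultiSpace X) :
    inner ℂ (applyLocal A ψ) (applyLocal A φ) =
      (∏ k ∈ {p}ᶜ, c k) * inner ℂ ψ (applyAt p ((A p)ᴴ * A p) φ) := by
  have h : (fun k => (A k)ᴴ * A k) = fun k => Function.update c p 1 k •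
      (Function.update (fun _ => 1) p ((A p)ᴴ * A p) : ∀ k, Matrix (X k) (X k) ℂ) k := by
    funext k
    by_cases hk : k = p
    · subst hk; simp
    · simp [hk, hc k hk]
  rw [inner_applyLocal_applyLocal, h, applyLocal_smul, inner_smul_right, applyAt,
    Fintype.prod_eq_mul_prod_compl p, Function.update_self, one_mul]
  congr 1
  refine Finset.prod_congr rfl fun k hk => ?_
  rw [Function.update_of_ne (by simpa using hk)]

theorem applyLocal_eq_zero_iff {X Y : κ → Type} [∀ k, Fintype (X k)]
    [∀ k, DecidableEq (X k)] [∀ k, Fintype (Y k)] (A : ∀ k, Matrix (Y k) (X k) ℂ) (c : κ → ℂ)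
    (hc : ∀ k, (A k)ᴴ * A k = c k • 1) (ψ : MultiSpace X) :
    applyLocal A ψ = 0 ↔ (∏ k, c k) = 0 ∨ ψ = 0 := by
  rw [← inner_self_eq_zero (𝕜 := ℂ), inner_applyLocal_applyLocal]
  simp only [hc]
  rw [applyLocal_smul, applyLocal_one, inner_smul_right, mul_eq_zero, inner_self_eq_zero]

theorem IsRigid.exists_scalar {X Y : κ → Type} [∀ k, Fintype (X k)]
    [∀ k, DecidableEq (X k)] [∀ k, Fintype (Y k)] {φ : J → MultiSpace X} (hφ : IsRigid φ)
    (A : ∀ k, Matrix (Y k) (X k) ℂ) (c : κ → ℂ) (p : κ) (hc0 : ∀ k, k ≠ p → c k ≠ 0)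
    (hc : ∀ k, k ≠ p → (A k)ᴴ * A k = c k • 1)
    (horth : ∀ i j, i ≠ j → inner ℂ (applyLocal A (φ i)) (applyLocal A (φ j)) = 0) :
    ∃ d : ℂ, (A p)ᴴ * A p = d • 1 := by
  refine hφ p _ fun i j hij => ?_
  have h := horth i j hij
  rw [inner_applyLocal_of_scalar A c p hc, mul_eq_zero, Finset.prod_eq_zero_iff] at h
  rcases h with ⟨k, hk, hk0⟩ | h
  · exact absurd hk0 (hc0 k (by simpa using hk))
  · exact h

theorem gram_mul {l m n : Type} [Fintype l] [Fintype m] (K : Matrix l m ℂ) (A : Matrix m n ℂ) :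
    (K * A)ᴴ * (K * A) = Aᴴ * (Kᴴ * K) * A := by
  simp only [Matrix.conjTranspose_mul, Matrix.mul_assoc]

theorem gram_mul_isometry {l m n : Type} [Fintype l] [Fintype m] [DecidableEq m]
    (K : Matrix l m ℂ) (A : Matrix m n ℂ) (hK : Kᴴ * K = 1) :
    (K * A)ᴴ * (K * A) = Aᴴ * A := by
  rw [gram_mul, hK, Matrix.mul_one]

namespace LOCC

theorem not_eliminates_zero {X : κ → Type} [∀ k, DecidableEq (X k)] [hX : ∀ k, Fintype (X k)]
    (P : LOCC X) (φ : J → MultiSpace X) (hφ : ∀ j, φ j = 0) : ¬ P.Eliminates φ := by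
  induction P generalizing hX with
  | halt => rintro ⟨-, j, hj⟩; exact hj (hφ j)
  | round p m n K hK hI next ih =>
    rintro ⟨o, ho⟩
    refine ih o _ (fun j => ?_) ho
    ext y
    simp [applyLocal_apply, hφ j]

/-- Along an orthogonality preserving protocol, the states of a rigid family only undergo multiples
of local isometries, so that none of them is eliminated before all of them vanish. -/
theorem not_eliminates_of_isRigid {X Y : κ → Type} [∀ k, DecidableEq (X k)] [∀ k, Fintype (X k)]
    [∀ k, DecidableEq (Y k)] [hY : ∀ k, Fintype (Y k)] (ψ : J → MultiSpace X) (hψ : IsRigid ψ)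
    (hψ0 : ∀ j, ψ j ≠ 0) (P : LOCC Y) (A : ∀ k, Matrix (Y k) (X k) ℂ) (c : κ → ℂ)
    (hc : ∀ k, (A k)ᴴ * A k = c k • 1)
    (hP : P.OrthogonalityPreserving fun j => applyLocal A (ψ j)) :
    ¬ P.Eliminates fun j => applyLocal A (ψ j) := by
  by_cases hc0 : ∏ k, c k = 0
  · exact not_eliminates_zero _ _ fun j => (applyLocal_eq_zero_iff A c hc _).mpr (Or.inl hc0)
  induction P generalizing hY c with
  | halt =>
    rintro ⟨⟨i, hi⟩, -⟩
    rcases (applyLocal_eq_zero_iff A c hc _).mp hi with h | h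
    · exact hc0 h
    · exact hψ0 i h
  | round p m n K hK hI next ih =>
    rintro ⟨o, ho⟩
    obtain ⟨horth, hnext⟩ := hP o
    simp only [applyLocal_comp] at horth hnext ho
    have hI' : ∀ k, k ≠ p → (K o k * A k)ᴴ * (K o k * A k) = c k • 1 := fun k hk => by
      rw [gram_mul_isometry _ _ (hI o k hk), hc]
    obtain ⟨d, hd⟩ := hψ.exists_scalar (fun k => K o k * A k) c p
      (fun k _ h => hc0 (Finset.prod_eq_zero (Finset.mem_univ k) h)) hI' horth
    have hall : ∀ k, (K o k * A k)ᴴ * (K o k * A k) = Function.update c p d k • 1 := fun k => by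
      by_cases hk : k = p
      · subst hk; simpa using hd
      · rw [hI' k hk, Function.update_of_ne hk]
    by_cases h0 : ∏ k, Function.update c p d k = 0
    · exact not_eliminates_zero _ _
        (fun j => (applyLocal_eq_zero_iff _ _ hall _).mpr (Or.inl h0)) ho
    · exact ih o _ _ hall hnext h0 ho

/-- States that are perfectly discriminated are orthogonal: the inner product of two states is the
sum, over the outcomes, of the inner products of the post-measurement states. -/
theorem PerfectlyDiscriminates.inner_eq_zero {X : κ → Type} [∀ k, DecidableEq (X k)]
    [hX : ∀ k, Fintype (X k)] {P : LOCC X} {φ : J → MultiSpace X} (hP : P.PerfectlyDiscriminates φ)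
    {i j : J} (hij : i ≠ j) : inner ℂ (φ i) (φ j) = 0 := by
  induction P generalizing hX with
  | halt =>
    obtain ⟨l, hl⟩ := hP
    by_cases hi : i = l
    · rw [hl j (fun h => hij (hi.trans h.symm)), inner_zero_right]
    · rw [hl i hi, inner_zero_left]
  | round p m n K hK hI next ih =>
    rw [← sum_applyAt p (fun o => (K o p)ᴴ * K o p) hK (φ j), inner_sum]
    refine Finset.sum_eq_zero fun o _ => ?_
    have h := ih o (hP o)
    rw [inner_applyLocal_of_scalar (K o) (fun _ => 1) p (fun k hk => by rw [hI o k hk, one_smul]),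
      Finset.prod_const_one, one_mul] at h
    exact h

/-- A family of states cannot be perfectly discriminated if a part of it is the image of a rigid
family under local isometries (up to nonzero factors). -/
theorem not_perfectlyDiscriminates_of_isRigid {X Y : κ → Type} [∀ k, DecidableEq (X k)]
    [∀ k, Fintype (X k)] [∀ k, Nonempty (X k)] [∀ k, DecidableEq (Y k)] [hY : ∀ k, Fintype (Y k)]
    {I : Type} [Nontrivial I] (ψ : I → MultiSpace X) (hψ : IsRigid ψ) (hψ0 : ∀ i, ψ i ≠ 0)
    (f : I → J) (hf : Function.Injective f) (P : LOCC Y) (φ : J → MultiSpace Y)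
    (A : ∀ k, Matrix (Y k) (X k) ℂ) (hA : ∀ i, φ (f i) = applyLocal A (ψ i))
    (c : κ → ℂ) (hc : ∀ k, (A k)ᴴ * A k = c k • 1) (hc0 : ∀ k, c k ≠ 0) :
    ¬ P.PerfectlyDiscriminates φ := by
  intro hP
  induction P generalizing hY c with
  | halt =>
    obtain ⟨l, hl⟩ := hP
    obtain ⟨i, hi⟩ : ∃ i, f i ≠ l := by
      obtain ⟨a, b, hab⟩ := exists_pair_ne I
      by_contra! h
      exact hab (hf ((h a).trans (h b).symm))
    have h0 := hl _ hi
    rw [hA, applyLocal_eq_zero_iff A c hc, Finset.prod_eq_zero_iff] at h0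
    rcases h0 with ⟨k, -, hk⟩ | h0
    · exact hc0 k hk
    · exact hψ0 i h0
  | round p m n K hK hI next ih =>
    have hI' : ∀ o k, k ≠ p → (K o k * A k)ᴴ * (K o k * A k) = c k • 1 := fun o k hk => by
      rw [gram_mul_isometry _ _ (hI o k hk), hc]
    have hA' : ∀ o i, applyLocal (K o) (φ (f i)) = applyLocal (fun k => K o k * A k) (ψ i) :=
      fun o i => by rw [hA, applyLocal_comp]
    have hd : ∀ o, ∃ d : ℂ, (K o p * A p)ᴴ * (K o p * A p) = d • 1 := fun o =>
      hψ.exists_scalar (fun k => K o k * A k) c p (fun k _ => hc0 k) (hI' o) fun i j hij => by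
        rw [← hA', ← hA']
        exact PerfectlyDiscriminates.inner_eq_zero (hP o) (fun h => hij (hf h))
    choose d hd using hd
    -- The probabilities of the outcomes add up, so that some outcome has nonzero probability.
    obtain ⟨o, ho⟩ : ∃ o, d o ≠ 0 := by
      by_contra! h
      have hsum : ∑ o, (K o p * A p)ᴴ * (K o p * A p) = c p • 1 := by
        simp only [gram_mul]
        rw [← Matrix.sum_mul, ← Matrix.mul_sum, hK, Matrix.mul_one, hc]
      simp only [hd, h, zero_smul, Finset.sum_const_zero] at hsum
      exact (smul_ne_zero (hc0 p) one_ne_zero) hsum.symm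
    refine ih o _ _ (hA' o) (Function.update c p (d o)) (fun k => ?_) (fun k => ?_) (hP o)
    · by_cases hk : k = p
      · subst hk; simpa using hd o
      · rw [hI' o k hk, Function.update_of_ne hk]
    · by_cases hk : k = p
      · subst hk; simpa using ho
      · rw [Function.update_of_ne hk]; exact hc0 k

end LOCC

end Rigidity

/-! ### Labels of single-party states -/

section Labels

/-- Labels of the states of `ℂ^(n+1)` that occur as factors: `inl i` stands for `|i⟩`, and
`inr (i, s)` for `(|i⟩ ± |i+1⟩) / √2`, with the minus sign if `s` is true. -/
abbrev Label (n : ℕ) : Type := Fin (n + 1) ⊕ (Fin n × Bool)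

namespace Label

variable {n : ℕ}

/-- The integer vector proportional to the state with a given label. -/
def intVec : Label n → Fin (n + 1) → ℤ
  | .inl i => fun x => if x = i then 1 else 0
  | .inr (i, s) => fun x =>
      if x = i.castSucc then 1 else if x = i.succ then (if s then -1 else 1) else 0

/-- The integer inner product, which decides orthogonality of the states with given labels. -/
def dot (l l' : Label n) : ℤ := ∑ x, l.intVec x * l'.intVec x

/-- The factor that normalizes the integer vector. -/
noncomputable def scale : Label n → ℝ
  | .inl _ => 1
  | .inr _ => 1 / Real.sqrt 2

theorem scale_pos (l : Label n) : 0 < l.scale := by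
  rcases l with i | i <;> simp [scale]

/-- The state with a given label. -/
noncomputable def vec (l : Label n) : EuclideanSpace ℂ (Fin (n + 1)) :=
  WithLp.toLp 2 fun x => (l.scale : ℂ) * (l.intVec x : ℂ)

theorem vec_apply (l : Label n) (x : Fin (n + 1)) :
    l.vec x = (l.scale : ℂ) * (l.intVec x : ℂ) := rfl

theorem inner_vec (l l' : Label n) :
    inner ℂ l.vec l'.vec = ((l.scale * l'.scale * (l.dot l' : ℤ) : ℝ) : ℂ) := by
  simp only [PiLp.inner_apply, vec_apply, RCLike.inner_apply, dot]
  push_cast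
  rw [Finset.mul_sum]
  refine Finset.sum_congr rfl fun x _ => ?_
  simp
  ring

theorem inner_vec_eq_zero_iff (l l' : Label n) : inner ℂ l.vec l'.vec = 0 ↔ l.dot l' = 0 := by
  rw [inner_vec, Complex.ofReal_eq_zero]
  simp [(scale_pos l).ne', (scale_pos l').ne']

theorem dot_inl_inl (i j : Fin (n + 1)) :
    dot (.inl i : Label n) (.inl j) = if i = j then 1 else 0 := by
  simp [dot, intVec, eq_comm]

theorem sum_inr (i : Fin n) {R : Type} [AddCommMonoid R] (f : Fin (n + 1) → R)
    (hf : ∀ x, x ≠ i.castSucc → x ≠ i.succ → f x = 0) :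
    ∑ x, f x = f i.castSucc + f i.succ :=
  Fintype.sum_eq_add _ _ (Fin.castSucc_lt_succ).ne fun x hx => hf x hx.1 hx.2

theorem intVec_inr_castSucc (i : Fin n) (s : Bool) :
    intVec (.inr (i, s) : Label n) i.castSucc = 1 := by simp [intVec]

theorem intVec_inr_succ (i : Fin n) (s : Bool) :
    intVec (.inr (i, s) : Label n) i.succ = if s then -1 else 1 := by
  simp [intVec, (Fin.castSucc_lt_succ (i := i)).ne']

theorem intVec_inr_of_ne (i : Fin n) (s : Bool) {x : Fin (n + 1)} (h : x ≠ i.castSucc)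
    (h' : x ≠ i.succ) : intVec (.inr (i, s) : Label n) x = 0 := by
  simp [intVec, h, h']

theorem dot_inr_inr (i : Fin n) (s t : Bool) :
    dot (.inr (i, s) : Label n) (.inr (i, t)) = if s = t then 2 else 0 := by
  rw [dot, sum_inr i _ fun x h h' => by rw [intVec_inr_of_ne i s h h', zero_mul]]
  simp only [intVec_inr_castSucc, intVec_inr_succ]
  cases s <;> cases t <;> rfl

theorem inner_vec_self (l : Label n) : inner ℂ l.vec l.vec = 1 := by
  rw [inner_vec]
  rcases l with i | ⟨i, s⟩
  · simp [dot_inl_inl, scale]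
  · rw [dot_inr_inr]
    have h : (Real.sqrt 2)⁻¹ * (Real.sqrt 2)⁻¹ = 2⁻¹ := by
      rw [← mul_inv, Real.mul_self_sqrt zero_le_two]
    simp only [scale, one_div, h]
    norm_num

theorem inner_inl_mulVec_inl (M : Matrix (Fin (n + 1)) (Fin (n + 1)) ℂ) (i j : Fin (n + 1)) :
    inner ℂ (vec (.inl i : Label n)) (WithLp.toLp 2 (M *ᵥ vec (.inl j : Label n))) = M i j := by
  simp [PiLp.inner_apply, vec_apply, intVec, scale, Matrix.mulVec, dotProduct]

theorem inner_inr_mulVec_inr (M : Matrix (Fin (n + 1)) (Fin (n + 1)) ℂ) (i : Fin n)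
    (h : M i.castSucc i.succ = 0) (h' : M i.succ i.castSucc = 0) :
    inner ℂ (vec (.inr (i, false) : Label n))
      (WithLp.toLp 2 (M *ᵥ vec (.inr (i, true) : Label n))) =
      (M i.castSucc i.castSucc - M i.succ i.succ) / 2 := by
  have h2 : ((Real.sqrt 2 : ℝ) : ℂ)⁻¹ * ((Real.sqrt 2 : ℝ) : ℂ)⁻¹ = 2⁻¹ := by
    rw [← mul_inv, ← Complex.ofReal_mul, Real.mul_self_sqrt zero_le_two]
    norm_num
  have hM : ∀ y, (M *ᵥ (vec (.inr (i, true) : Label n)).ofLp) y =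
      ((Real.sqrt 2 : ℝ) : ℂ)⁻¹ * (M y i.castSucc - M y i.succ) := fun y => by
    rw [Matrix.mulVec, dotProduct, sum_inr i _ fun x h h' => by
      rw [vec_apply, intVec_inr_of_ne i _ h h']; simp]
    simp only [vec_apply, intVec_inr_castSucc, intVec_inr_succ, scale]
    push_cast
    simp
    ring
  simp only [PiLp.inner_apply, RCLike.inner_apply]
  rw [sum_inr i _ fun x h h' => by rw [vec_apply, intVec_inr_of_ne i _ h h']; simp]
  simp only [hM, vec_apply, intVec_inr_castSucc, intVec_inr_succ, scale, h, h']
  simp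
  linear_combination (M i.castSucc i.castSucc - M i.succ i.succ) * h2

/-- Labels of `ℂ^(n+1)` are also labels of `ℂ^(n+2)`. -/
def castSucc : Label n → Label (n + 1)
  | .inl i => .inl i.castSucc
  | .inr (i, s) => .inr (i.castSucc, s)

theorem intVec_castSucc_castSucc (l : Label n) (x : Fin (n + 1)) :
    l.castSucc.intVec x.castSucc = l.intVec x := by
  rcases l with i | ⟨i, s⟩ <;> simp [castSucc, intVec, ← Fin.castSucc_succ]

theorem intVec_castSucc_last (l : Label n) : l.castSucc.intVec (Fin.last (n + 1)) = 0 := by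
  rcases l with i | ⟨i, s⟩
  · simp [castSucc, intVec, (Fin.castSucc_lt_last _).ne']
  · refine intVec_inr_of_ne _ _ (Fin.castSucc_lt_last _).ne' ?_
    rw [Fin.succ_castSucc]
    exact (Fin.castSucc_lt_last _).ne'

theorem scale_castSucc (l : Label n) : l.castSucc.scale = l.scale := by
  rcases l with i | ⟨i, s⟩ <;> rfl

theorem vec_castSucc_castSucc (l : Label n) (x : Fin (n + 1)) :
    l.castSucc.vec x.castSucc = l.vec x := by
  rw [vec_apply, vec_apply, scale_castSucc, intVec_castSucc_castSucc]

theorem vec_castSucc_last (l : Label n) : l.castSucc.vec (Fin.last (n + 1)) = 0 := by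
  rw [vec_apply, intVec_castSucc_last]; simp

end Label

variable {κ : Type} [Fintype κ] {n : ℕ}

/-- The product state whose factors have given labels. -/
noncomputable def labelState (t : κ → Label n) : MultiSpace fun _ : κ => Fin (n + 1) :=
  prodState fun k => (t k).vec

theorem inner_labelState [DecidableEq κ] (t t' : κ → Label n) :
    inner ℂ (labelState t) (labelState t') = ∏ k, inner ℂ (t k).vec (t' k).vec :=
  inner_prodState _ _

theorem norm_labelState [DecidableEq κ] (t : κ → Label n) : ‖labelState t‖ = 1 := by
  have h : inner ℂ (labelState t) (labelState t) = (1 : ℂ) := by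
    rw [inner_labelState]; exact Finset.prod_eq_one fun k _ => Label.inner_vec_self _
  rw [@norm_eq_sqrt_re_inner ℂ, h]
  simp

theorem labelState_ne_zero [DecidableEq κ] (t : κ → Label n) : labelState t ≠ 0 := by
  rw [← norm_ne_zero_iff, norm_labelState]; exact one_ne_zero

theorem inner_labelState_eq_zero [DecidableEq κ] {t t' : κ → Label n}
    (h : ∃ k, (t k).dot (t' k) = 0) : inner ℂ (labelState t) (labelState t') = 0 := by
  obtain ⟨k, hk⟩ := h
  rw [inner_labelState]
  exact Finset.prod_eq_zero (Finset.mem_univ k) ((Label.inner_vec_eq_zero_iff _ _).mpr hk)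

theorem labelState_ne [DecidableEq κ] {t t' : κ → Label n}
    (h : ∃ k, (t k).dot (t' k) = 0) : labelState t ≠ labelState t' := by
  intro heq
  have h0 := inner_labelState_eq_zero h
  rw [heq, inner_self_eq_zero] at h0
  exact labelState_ne_zero t' h0

/-- A combinatorial criterion for rigidity.  If two states carry `|i⟩` and `|j⟩` at the party `p`
and their other factors are not orthogonal, then the entry `M i j` vanishes; likewise, two states
that carry `(|i⟩ + |i+1⟩)/√2` and `(|i⟩ - |i+1⟩)/√2` at `p` give `M i i = M (i+1) (i+1)`. -/
theorem isRigid_of_labels [DecidableEq κ] {J : Type}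
    (φ : J → MultiSpace fun _ : κ => Fin (n + 1)) (T : Finset (κ → Label n))
    (hT : ∀ t ∈ T, ∃ j, φ j = labelState t)
    (hket : ∀ p : κ, ∀ i j : Fin (n + 1), i ≠ j → ∃ t ∈ T, t p = .inl i ∧ ∃ t' ∈ T, t' p = .inl j ∧
      ∀ k, k ≠ p → (t k).dot (t' k) ≠ 0)
    (hpm : ∀ p : κ, ∀ i : Fin n, ∃ t ∈ T, t p = .inr (i, false) ∧ ∃ t' ∈ T,
      t' p = .inr (i, true) ∧ ∀ k, k ≠ p → (t k).dot (t' k) ≠ 0) :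
    IsRigid φ := by
  intro p M hM
  have key : ∀ t ∈ T, ∀ t' ∈ T, (t p).dot (t' p) = 0 → (∀ k, k ≠ p → (t k).dot (t' k) ≠ 0) →
      inner ℂ (t p).vec (WithLp.toLp 2 (M *ᵥ (t' p).vec)) = 0 := by
    intro t ht t' ht' hp hk
    obtain ⟨i, hi⟩ := hT t ht
    obtain ⟨j, hj⟩ := hT t' ht'
    have hij : i ≠ j := by
      rintro rfl
      exact labelState_ne ⟨p, hp⟩ (hi.symm.trans hj)
    have h := hM i j hij
    rw [hi, hj, labelState, labelState, inner_applyAt_prodState, mul_eq_zero] at h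
    refine h.resolve_right (Finset.prod_ne_zero_iff.mpr fun k hkp => ?_)
    rw [Ne, Label.inner_vec_eq_zero_iff]
    exact hk k (by simpa using hkp)
  have hoff : ∀ i j, i ≠ j → M i j = 0 := by
    intro i j hij
    obtain ⟨t, ht, hti, t', ht', htj, hk⟩ := hket p i j hij
    have h := key t ht t' ht' (by rw [hti, htj, Label.dot_inl_inl, if_neg hij]) hk
    rwa [hti, htj, Label.inner_inl_mulVec_inl] at h
  have hdiag : ∀ i : Fin n, M i.succ i.succ = M i.castSucc i.castSucc := by
    intro i
    obtain ⟨t, ht, hti, t', ht', htj, hk⟩ := hpm p i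
    have h := key t ht t' ht' (by rw [hti, htj, Label.dot_inr_inr]; rfl) hk
    rw [hti, htj, Label.inner_inr_mulVec_inr M i (hoff _ _ Fin.castSucc_lt_succ.ne)
      (hoff _ _ Fin.castSucc_lt_succ.ne')] at h
    exact (sub_eq_zero.mp ((div_eq_zero_iff.mp h).resolve_right two_ne_zero)).symm
  refine ⟨M 0 0, ?_⟩
  have hconst : ∀ i, M i i = M 0 0 := fun i => by
    induction i using Fin.induction with
    | zero => rfl
    | succ i ih => rw [hdiag, ih]
  ext i j
  by_cases hij : i = j
  · subst hij; simp [hconst i]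
  · simp [hij, hoff i j hij]

end Labels

/-! ### Parties that come together -/

section Regroup

variable {ι κ : Type} [DecidableEq ι] {n : ℕ}

/-- The basis state of the group `k` in which the representative `r k` is in the state `|b⟩`, with
`b ≤ n`, and all the other members are in the last basis state `|n+1⟩`. -/
def groupIndex (g : ι → κ) (r : κ → ι) (k : κ) (b : Fin (n + 1)) :
    Grouped g (fun _ => Fin (n + 2)) k :=
  fun i => if (i : ι) = r k then b.castSucc else Fin.last (n + 1)

theorem groupIndex_injective (g : ι → κ) (r : κ → ι) (hr : ∀ k, g (r k) = k) (k : κ) :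
    Function.Injective (groupIndex (n := n) g r k) := by
  intro b b' h
  have h' := congrFun h ⟨r k, hr k⟩
  simpa [groupIndex] using h'

variable [Fintype ι] [DecidableEq κ]

/-- The isometric embedding of `ℂ^(n+1)` into the system of the group `k` given by `groupIndex`. -/
def groupEmbedding (g : ι → κ) (r : κ → ι) (k : κ) :
    Matrix (Grouped g (fun _ => Fin (n + 2)) k) (Fin (n + 1)) ℂ :=
  fun y b => if y = groupIndex g r k b then 1 else 0

theorem groupEmbedding_gram (g : ι → κ) (r : κ → ι) (hr : ∀ k, g (r k) = k) (k : κ) :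
    (groupEmbedding (n := n) g r k)ᴴ * groupEmbedding (n := n) g r k = 1 := by
  ext b b'
  simp [Matrix.mul_apply, groupEmbedding, Matrix.one_apply, apply_ite,
    (groupIndex_injective g r hr k).eq_iff, eq_comm]

theorem regroup_labelState [Fintype κ] (g : ι → κ) (r : κ → ι)
    (hr : ∀ k, g (r k) = k)
    (t : ι → Label (n + 1)) (s : κ → Label n) (hs : ∀ k, t (r k) = (s k).castSucc)
    (ht : ∀ i, i ≠ r (g i) → t i = .inl (Fin.last (n + 1))) :
    regroup g (labelState t) = applyLocal (groupEmbedding g r) (labelState s) := by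
  rw [labelState, labelState, applyLocal_prodState]
  ext y
  rw [prodState_apply]
  change ∏ i, (t i).vec (y (g i) ⟨i, rfl⟩) = _
  rw [← Fintype.prod_fiberwise g]
  refine Finset.prod_congr rfl fun k _ => ?_
  have hmem : ∀ i : {i // g i = k}, y (g i) ⟨i, rfl⟩ = y k i := by
    rintro ⟨i, rfl⟩; rfl
  simp only [hmem]
  change _ = ∑ b, groupEmbedding g r k (y k) b * (s k).vec b
  generalize y k = z
  simp only [groupEmbedding, ite_mul, one_mul, zero_mul]
  by_cases hz : ∃ b, z = groupIndex g r k b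
  · obtain ⟨b, rfl⟩ := hz
    simp only [(groupIndex_injective g r hr k).eq_iff]
    rw [Fintype.prod_eq_single (⟨r k, hr k⟩ : {i // g i = k})]
    · simp [groupIndex, hs, Label.vec_castSucc_castSucc]
    · rintro ⟨i, rfl⟩ hi
      have hi' : i ≠ r (g i) := fun h => hi (Subtype.ext h)
      simp [groupIndex, hi', ht i hi', Label.vec_apply, Label.scale, Label.intVec]
  · have hsum : ∀ b, z ≠ groupIndex g r k b := fun b hb => hz ⟨b, hb⟩
    simp only [hsum, if_false, Finset.sum_const_zero]
    by_cases hlast : z ⟨r k, hr k⟩ = Fin.last (n + 1)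
    · refine Finset.prod_eq_zero (Finset.mem_univ (⟨r k, hr k⟩ : {i // g i = k})) ?_
      rw [hlast, hs, Label.vec_castSucc_last]
    · obtain ⟨b, hb⟩ := Fin.exists_castSucc_eq.mpr hlast
      obtain ⟨i, hi⟩ := Function.ne_iff.mp (hsum b)
      refine Finset.prod_eq_zero (Finset.mem_univ i) ?_
      obtain ⟨i, rfl⟩ := i
      by_cases hir : i = r (g i)
      · refine absurd ?_ hi
        have hsub : (⟨i, rfl⟩ : {j // g j = g i}) = ⟨r (g i), hr _⟩ := Subtype.ext hir
        rw [hsub, ← hb]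
        simp [groupIndex]
      · simp only [groupIndex, hir, if_false] at hi
        simp [ht i hir, Label.vec_apply, Label.scale, Label.intVec, hi]

end Regroup

/-! ### The labels of the basis -/

namespace Label

/-- Whether the states with given labels are not orthogonal, read off from the indices: the kernel
evaluates this test faster than `dot`. -/
def overlaps {n : ℕ} : Label n → Label n → Bool
  | .inl i, .inl j => Nat.beq i j
  | .inl i, .inr (j, _) => Nat.beq i j || Nat.beq i (j + 1)
  | .inr (i, _), .inl j => Nat.beq j i || Nat.beq j (i + 1)
  | .inr (i, s), .inr (j, t) =>
      (Nat.beq i j && (s == t)) || Nat.beq j (i + 1) || Nat.beq i (j + 1)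

theorem dot_eq_zero_of_overlaps :
    ∀ l l' : Label 3, l.overlaps l' = false → l.dot l' = 0 := by decide +kernel

theorem vec_inl (i : Fin 4) : vec (.inl i : Label 3) = ket i := by
  ext x
  simp [vec_apply, scale, intVec, ket]

theorem vec_inr_false (i : Fin 3) :
    vec (.inr (i, false) : Label 3) = plus i.castSucc i.succ := by
  ext x
  fin_cases i <;> fin_cases x <;> simp [vec_apply, scale, intVec, plus, ket]

theorem vec_inr_true (i : Fin 3) :
    vec (.inr (i, true) : Label 3) = minus i.castSucc i.succ := by
  ext x
  fin_cases i <;> fin_cases x <;> simp [vec_apply, scale, intVec, minus, ket]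

end Label

theorem labelState_vec3 (a b c : Label 3) : labelState ![a, b, c] = tri a.vec b.vec c.vec := by
  rw [labelState, tri]
  congr 1
  funext k
  fin_cases k <;> rfl

/-- The labels of the nine two-qutrit states. -/
def dominoLabels : Finset (Label 2 × Label 2) :=
  {(.inl 0, .inr (0, false)), (.inl 0, .inr (0, true)),
   (.inr (0, false), .inl 2), (.inr (0, true), .inl 2),
   (.inl 2, .inr (1, false)), (.inl 2, .inr (1, true)),
   (.inr (1, false), .inl 0), (.inr (1, true), .inl 0),
   (.inl 1, .inl 1)}

/-- The labels of the computational basis states of three ququarts. -/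
def ketLabels (l : Fin 4 × Fin 4 × Fin 4) : Fin 3 → Label 3 := ![.inl l.1, .inl l.2.1, .inl l.2.2]

/-- The labels of the eighteen states `|3⟩|β⟩` and `|β⟩|3⟩`. -/
def labelsS : Finset (Fin 3 → Label 3) :=
  dominoLabels.image (fun b => ![.inl 3, b.1.castSucc, b.2.castSucc]) ∪
    dominoLabels.image (fun b => ![b.1.castSucc, b.2.castSucc, .inl 3])

/-- The labels of `B_I(4,3)`. -/
def labelsI : Finset (Fin 3 → Label 3) := labelsS ∪ labelsR.image ketLabels

/-- The computational basis states of `B_I(4,3)` that do not belong to `B_II(4,3)`. -/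
def labelsRemoved : Finset (Fin 4 × Fin 4 × Fin 4) :=
  {(0, 3, 2), (0, 3, 3), (2, 2, 2), (2, 3, 2), (2, 3, 1), (3, 3, 1)}

/-- The labels of the states of `B_II(4,3)` that do not belong to `B_I(4,3)`. -/
def labelsAdded : Finset (Fin 3 → Label 3) :=
  Finset.univ.image (fun s => ![.inl 0, .inl 3, .inr (2, s)]) ∪
    Finset.univ.image (fun s => ![.inl 2, .inr (2, s), .inl 2]) ∪
    Finset.univ.image (fun s => ![.inr (2, s), .inl 3, .inl 1])

/-- The labels of `B_II(4,3)`. -/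
def labelsII : Finset (Fin 3 → Label 3) :=
  (labelsI \ labelsRemoved.image ketLabels) ∪ labelsAdded

theorem mem_dominoes_iff (b : Ququart × Ququart) :
    b ∈ dominoes ↔ ∃ l ∈ dominoLabels, b = (l.1.castSucc.vec, l.2.castSucc.vec) := by
  obtain ⟨b₁, b₂⟩ := b
  have hη : ∀ v, v ∈ etaStates ↔ v = Label.vec (.inr (0, false) : Label 3) ∨
      v = Label.vec (.inr (0, true) : Label 3) := fun v => by
    rw [Label.vec_inr_false, Label.vec_inr_true]; rfl
  have hξ : ∀ v, v ∈ xiStates ↔ v = Label.vec (.inr (1, false) : Label 3) ∨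
      v = Label.vec (.inr (1, true) : Label 3) := fun v => by
    rw [Label.vec_inr_false, Label.vec_inr_true]; rfl
  simp only [dominoes, Set.mem_union, Set.mem_ofPred_eq, Set.mem_singleton_iff, hη, hξ,
    ← Label.vec_inl, dominoLabels, Finset.mem_insert, Finset.mem_singleton, exists_eq_or_imp,
    exists_eq_left]
  simp only [Label.castSucc, Prod.mk.injEq, and_or_left, or_and_right, or_assoc]
  rfl

theorem setS_eq : setS = labelState '' (labelsS : Set (Fin 3 → Label 3)) := by
  ext ψ
  simp only [setS, labelsS, Set.mem_union, Set.mem_ofPred_eq, mem_dominoes_iff, Finset.coe_union,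
    Finset.coe_image, Set.image_union, Set.image_image, labelState_vec3, Set.mem_image,
    SetLike.mem_coe, ← Label.vec_inl]
  refine or_congr ⟨?_, ?_⟩ ⟨?_, ?_⟩
  · rintro ⟨_, ⟨l, hl, rfl⟩, rfl⟩; exact ⟨l, hl, rfl⟩
  · rintro ⟨l, hl, rfl⟩; exact ⟨_, ⟨l, hl, rfl⟩, rfl⟩
  · rintro ⟨_, ⟨l, hl, rfl⟩, rfl⟩; exact ⟨l, hl, rfl⟩
  · rintro ⟨l, hl, rfl⟩; exact ⟨_, ⟨l, hl, rfl⟩, rfl⟩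

theorem setR_eq : setR = labelState '' (labelsR.image ketLabels : Set (Fin 3 → Label 3)) := by
  ext ψ
  simp only [setR, Set.mem_ofPred_eq, Finset.coe_image, Set.image_image, Set.mem_image,
    SetLike.mem_coe, ketLabels, labelState_vec3, Label.vec_inl, eq_comm (a := ψ)]

theorem basisI_eq : basisI = labelState '' (labelsI : Set (Fin 3 → Label 3)) := by
  rw [basisI, setS_eq, setR_eq, labelsI, Finset.coe_union, Set.image_union]

theorem labelsI_eq_of_overlaps : ∀ t ∈ labelsI, ∀ t' ∈ labelsI, (t 0).overlaps (t' 0) = true →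
    (t 1).overlaps (t' 1) = true → (t 2).overlaps (t' 2) = true → t = t' := by
  decide +kernel

theorem labelsII_eq_of_overlaps : ∀ t ∈ labelsII, ∀ t' ∈ labelsII, (t 0).overlaps (t' 0) = true →
    (t 1).overlaps (t' 1) = true → (t 2).overlaps (t' 2) = true → t = t' := by
  decide +kernel

/-- Distinct labels of a set with this property belong to orthogonal states. -/
theorem exists_dot_eq_zero {T : Finset (Fin 3 → Label 3)}
    (hT : ∀ t ∈ T, ∀ t' ∈ T, (t 0).overlaps (t' 0) = true →
      (t 1).overlaps (t' 1) = true → (t 2).overlaps (t' 2) = true → t = t')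
    {t t' : Fin 3 → Label 3} (ht : t ∈ T) (ht' : t' ∈ T) (hne : t ≠ t') :
    ∃ k, (t k).dot (t' k) = 0 := by
  by_contra! h
  have h' : ∀ k, (t k).overlaps (t' k) = true := fun k => by
    by_contra hk
    exact h k (Label.dot_eq_zero_of_overlaps _ _ (Bool.eq_false_iff.mpr hk))
  exact hne (hT t ht t' ht' (h' 0) (h' 1) (h' 2))

theorem labelState_injOn {T : Finset (Fin 3 → Label 3)}
    (hT : ∀ t ∈ T, ∀ t' ∈ T, (t 0).overlaps (t' 0) = true →
      (t 1).overlaps (t' 1) = true → (t 2).overlaps (t' 2) = true → t = t') :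
    Set.InjOn labelState (T : Set (Fin 3 → Label 3)) := by
  intro t ht t' ht' h
  by_contra hne
  exact labelState_ne (exists_dot_eq_zero hT ht ht' hne) h

theorem basisII_eq : basisII = labelState '' (labelsII : Set (Fin 3 → Label 3)) := by
  have hsub : (labelsRemoved.image ketLabels : Set (Fin 3 → Label 3)) ⊆ labelsI := by
    have h : labelsRemoved.image ketLabels ⊆ labelsI := by decide +kernel
    exact_mod_cast h
  have hχ : chiStates = Set.range fun s : Bool => Label.vec (.inr (2, s) : Label 3) := by
    ext v
    rw [Set.mem_range, Bool.exists_bool, Label.vec_inr_false, Label.vec_inr_true,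
      eq_comm, eq_comm (b := v)]
    rfl
  rw [labelsII, Finset.coe_union, Finset.coe_sdiff, Set.image_union,
    Set.InjOn.image_sdiff_subset (labelState_injOn labelsI_eq_of_overlaps) hsub, ← basisI_eq,
    basisII]
  congr 1
  · congr 1
    simp only [labelsRemoved, Finset.image_insert, Finset.image_singleton, Finset.coe_insert,
      Finset.coe_singleton, Set.image_insert_eq, Set.image_singleton, ketLabels, labelState_vec3,
      Label.vec_inl]
  · simp only [labelsAdded, hχ, Finset.coe_union, Finset.coe_image, Finset.coe_univ,
      Set.image_univ, Set.image_union, ← Set.range_comp, Function.comp_def, labelState_vec3,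
      Label.vec_inl, Set.exists_range_iff]
    simp only [Set.range, eq_comm]

theorem card_labelsII : labelsII.card = 64 := by decide +kernel

/-! ### Orthonormality and completeness -/

theorem isOrthogonalProductBasis_basisII : IsOrthogonalProductBasis basisII := by
  have horth : Orthonormal ℂ fun t : labelsII => labelState (t : Fin 3 → Label 3) :=
    ⟨fun t => norm_labelState _, fun t t' h => inner_labelState_eq_zero
      (exists_dot_eq_zero labelsII_eq_of_overlaps t.2 t'.2 fun h' => h (Subtype.ext h'))⟩
  have hrange : basisII = Set.range fun t : labelsII => labelState (t : Fin 3 → Label 3) := by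
    rw [basisII_eq, Set.image_eq_range]; rfl
  refine ⟨?_, ?_, ?_⟩
  · rw [hrange]; exact horth.toSubtypeRange
  · rw [hrange]
    refine horth.linearIndependent.span_eq_top_of_card_eq_finrank' ?_
    rw [Fintype.card_coe, card_labelsII, finrank_euclideanSpace]
    simp
  · rw [basisII_eq]
    rintro _ ⟨t, -, rfl⟩
    exact ⟨_, rfl⟩

/-! ### Irreducibility and nonlocality -/

/-- The set `B_II(4,3)` is rigid.  The dominoes `|3⟩|β⟩` and `|β⟩|3⟩` give the entries of `M` with
indices below `3`, the computational basis states those that link `|3⟩` with the others, and the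
states with a factor `|χ±⟩`, one pair for each party, the equality of the last two diagonal
entries. -/
theorem isRigid_basisII : IsRigid fun ψ : basisII => (ψ : ThreeQuquarts) := by
  refine isRigid_of_labels _ labelsII (fun t ht => ⟨⟨labelState t, ?_⟩, rfl⟩)
    (by decide +kernel) (by decide +kernel)
  rw [basisII_eq]
  exact ⟨t, ht, rfl⟩

theorem isLocallyIrreducible_basisII : IsLocallyIrreducible basisII := by
  intro P hP
  have hne : ∀ ψ : basisII, (ψ : ThreeQuquarts) ≠ 0 := fun ψ =>
    isOrthogonalProductBasis_basisII.1.ne_zero ψ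
  have h := LOCC.not_eliminates_of_isRigid _ isRigid_basisII hne P (fun _ => 1) (fun _ => 1)
    (fun k => by simp)
  simp only [applyLocal_one] at h
  exact h hP

/-- The labels of a two-qutrit state whose first factor is held by the group `e`. -/
def dominoAt (e : Bool) (b : Label 2 × Label 2) (k : Bool) : Label 2 := if k = e then b.1 else b.2

theorem isRigid_dominoes (e : Bool) :
    IsRigid fun b : dominoLabels => labelState (dominoAt e b) := by
  refine isRigid_of_labels _ (dominoLabels.image (dominoAt e)) (fun t ht => ?_)
    (by revert e; decide +kernel) (by revert e; decide +kernel)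
  obtain ⟨b, hb, rfl⟩ := Finset.mem_image.mp ht
  exact ⟨⟨b, hb⟩, rfl⟩

/-- If every group `k` has a representative `r k` and the states of a set include the two-qutrit
states shared by the representatives, with all the other parties in the state `|3⟩`, then the groups
cannot perfectly discriminate the set. -/
theorem not_perfectlyDiscriminates_of_dominoes (g : Fin 3 → Bool) (r : Bool → Fin 3) (e : Bool)
    (t : Label 2 × Label 2 → Fin 3 → Label 3) (hr : ∀ k, g (r k) = k)
    (ht : ∀ b ∈ dominoLabels, t b ∈ labelsII)
    (htinj : Function.Injective t)
    (hrep : ∀ b k, t b (r k) = (dominoAt e b k).castSucc)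
    (hanc : ∀ b i, i ≠ r (g i) → t b i = .inl 3)
    (P : LOCC (Grouped g fun _ : Fin 3 => Fin 4)) :
    ¬ P.PerfectlyDiscriminates fun ψ : basisII => regroup g (ψ : ThreeQuquarts) := by
  have hmem : ∀ b ∈ dominoLabels, labelState (t b) ∈ basisII := fun b hb => by
    rw [basisII_eq]; exact ⟨_, ht b hb, rfl⟩
  have : Nontrivial dominoLabels :=
    ⟨⟨(.inl 1, .inl 1), by decide⟩, ⟨(.inl 0, .inr (0, false)), by decide⟩, by decide⟩
  refine LOCC.not_perfectlyDiscriminates_of_isRigid _ (isRigid_dominoes e)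
    (fun b => labelState_ne_zero _) (fun b => ⟨labelState (t b), hmem b b.2⟩) ?_ P _
    (groupEmbedding g r) (fun b => regroup_labelState g r hr _ _ (hrep b) (hanc b))
    (fun _ => 1) (fun k => by rw [groupEmbedding_gram g r hr, one_smul]) (fun _ => one_ne_zero)
  intro b b' h
  exact Subtype.ext (htinj (labelState_injOn labelsII_eq_of_overlaps (ht b b.2) (ht b' b'.2)
    (congrArg Subtype.val h)))

theorem Label.castSucc_injective {n : ℕ} : Function.Injective (Label.castSucc (n := n)) := by
  rintro (i | ⟨i, s⟩) (j | ⟨j, s'⟩) h <;> simp_all [Label.castSucc]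

theorem not_perfectlyDiscriminates_basisII (a : Fin 3)
    (P : LOCC (Grouped (fun i : Fin 3 => decide (i = a)) fun _ : Fin 3 => Fin 4)) :
    ¬ P.PerfectlyDiscriminates fun ψ : basisII =>
      regroup (fun i : Fin 3 => decide (i = a)) (ψ : ThreeQuquarts) := by
  have h1 : ∀ b ∈ dominoLabels, ![b.1.castSucc, b.2.castSucc, .inl 3] ∈ labelsII := by
    decide +kernel
  have h2 : ∀ b ∈ dominoLabels, ![.inl 3, b.1.castSucc, b.2.castSucc] ∈ labelsII := by
    decide +kernel
  have inj1 : Function.Injective fun b : Label 2 × Label 2 =>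
      (![b.1.castSucc, b.2.castSucc, .inl 3] : Fin 3 → Label 3) := fun b b' h =>
    Prod.ext (Label.castSucc_injective (congrFun h 0)) (Label.castSucc_injective (congrFun h 1))
  have inj2 : Function.Injective fun b : Label 2 × Label 2 =>
      (![.inl 3, b.1.castSucc, b.2.castSucc] : Fin 3 → Label 3) := fun b b' h =>
    Prod.ext (Label.castSucc_injective (congrFun h 1)) (Label.castSucc_injective (congrFun h 2))
  fin_cases a
  -- The cut `A|BC`: the state `|β⟩` of `A` and `B`, with `C` in the state `|3⟩`.
  · refine not_perfectlyDiscriminates_of_dominoes _ (fun k => if k then 0 else 1) true _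
      (by decide) h1 inj1 (fun b k => ?_) (fun b i hi => ?_) P
    · cases k <;> rfl
    · revert hi; fin_cases i <;> simp
  -- The cut `B|AC`: the same states.
  · refine not_perfectlyDiscriminates_of_dominoes _ (fun k => if k then 1 else 0) false _
      (by decide) h1 inj1 (fun b k => ?_) (fun b i hi => ?_) P
    · cases k <;> rfl
    · revert hi; fin_cases i <;> simp
  -- The cut `C|AB`: the state `|β⟩` of `B` and `C`, with `A` in the state `|3⟩`.
  · refine not_perfectlyDiscriminates_of_dominoes _ (fun k => if k then 2 else 1) false _
      (by decide) h2 inj2 (fun b k => ?_) (fun b i hi => ?_) P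
    · cases k <;> rfl
    · revert hi; fin_cases i <;> simp

/-! ### The theorem -/

theorem proposition2 :
    IsGenuinelyNonlocalProductBasis basisII ∧ IsLocallyIrreducible basisII :=
  ⟨⟨isOrthogonalProductBasis_basisII, fun a ⟨P, hP⟩ => not_perfectlyDiscriminates_basisII a P hP⟩,
    isLocallyIrreducible_basisII⟩
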